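/- Notation. Let $\Omega\subseteq\mathbb R^d$ be open and let $F$ be a locally convex, Hausdorff, real topological vector space (not necessarily complete). For $\ell\in\mathbb N_0\cup\{\infty\}$, $C^\ell(\Omega,F)$ is the vector space of all continuous $\gamma\colon\Omega\to F$ whose partial derivatives $\partial^\alpha\gamma\colon\Omega\to F$ exist and are continuous for all multi-indices $\alpha\in\mathbb N_0^d$ with $|\alpha|\le\ell$; it carries the compact-open $C^\ell$-topology, i.e. the initial topology with respect to the maps $\partial^\alpha\colon C^\ell(\Omega,F)\to C(\Omega,F)$, $|\alpha|\le\ell$, where $C(\Omega,F)$ has the compact-open topology. For compact $K\subseteq\Omega$, $C^\ell_K(\Omega,F)$ is the subspace of all $\gamma\in C^\ell(\Omega,F)$ with support contained in $K$, and $F\otimes C^\infty_K(\Omega,\mathbb R)$ is identified with its image in $C^\infty(\Omega,F)$ under the linear map determined by $v\otimes\eta\mapsto(x\mapsto\eta(x)v)$. A compact exhaustion of $\Omega$ is a sequence $(K_n)_{n\in\mathbb N}$ of compact subsets with $\Omega=\bigcup_n K_n$ and $K_n$ contained in the interior of $K_{n+1}$ for each $n$. Theorem. Let $\Omega\subseteq\mathbb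 R^d$ be open, $F$ a locally convex, Hausdorff, real topological vector space, $(K_n)_{n\in\mathbb N}$ a compact exhaustion of $\Omega$, and $\ell\in\mathbb N_0$. Then there exist continuous linear operators $S_n\colon C^\ell(\Omega,F)\to C^\infty(\Omega,F)$, $n\in\mathbb N$, such that (a) $S_n(\gamma)\to\gamma$ in $C^\ell(\Omega,F)$ as $n\to\infty$, for all $\gamma\in C^\ell(\Omega,F)$; (b) $S_n(\gamma)\in F\otimes C^\infty_{K_{n+1}}(\Omega,\mathbb R)$ for all $n\in\mathbb N$ and $\gamma\in C^\ell(\Omega,F)$; (c) $S_m(\gamma)\in F\otimes C^\infty_{K_{n+1}}(\Omega,\mathbb R)$ for all $n\in\mathbb N$, $m\ge n$ and $\gamma\in C^\ell_{K_n}(\Omega,F)$. -/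

import Mathlib

open Filter Topology TensorProduct

noncomputable section CkDefs

namespace VectorCk

variable {d : ℕ} {Ω : TopologicalSpace.Opens (Fin d → ℝ)}
  {F : Type*} [AddCommGroup F] [Module ℝ F] [TopologicalSpace F]

/-- The `i`-th difference quotient of `γ : Ω → F` at `x`, with increment `t`. The point `x + t eᵢ`
lies in the open set `Ω` for all small `t`; elsewhere `γ` is (irrelevantly) extended by `0`. -/
def diffQuot (i : Fin d) (γ : Ω → F) (x : Ω) (t : ℝ) : F :=
  t⁻¹ • (Function.extend (Subtype.val : Ω → (Fin d → ℝ)) γ 0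
    ((x : Fin d → ℝ) + t • Pi.single i (1 : ℝ)) - γ x)

/-- `v` is the `i`-th partial derivative of `γ` at `x`, i.e. the limit of the difference quotients
in the topological vector space `F`. -/
def HasPartialAt (i : Fin d) (γ : Ω → F) (x : Ω) (v : F) : Prop :=
  Tendsto (diffQuot i γ x) (𝓝[≠] (0 : ℝ)) (𝓝 v)

open Classical in
/-- The `i`-th partial derivative of `γ` (with value `0` at points where it does not exist). -/
def pderiv (i : Fin d) (γ : Ω → F) (x : Ω) : F :=
  if h : ∃ v, HasPartialAt i γ x v then h.choose else 0

/-- Iterated partial derivatives `∂_{i₁} (∂_{i₂} (⋯ ∂_{iₖ} γ))` along a word `[i₁, …, iₖ]`. -/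
def wordDeriv : List (Fin d) → (Ω → F) → (Ω → F)
  | [], γ => γ
  | i :: w, γ => pderiv i (wordDeriv w γ)

/-- All the partial derivatives taken successively in forming `wordDeriv w γ` exist on `Ω`. -/
def WordDerivExists : List (Fin d) → (Ω → F) → Prop
  | [], _ => True
  | i :: w, γ => WordDerivExists w γ ∧ ∀ x, ∃ v, HasPartialAt i (wordDeriv w γ) x v

/-- The word of the multi-index `α`, namely `α 0` times the first coordinate, then `α 1` times the
second coordinate, and so on. -/
def indexWord (α : Fin d → ℕ) : List (Fin d) :=
  (List.finRange d).flatMap fun i => List.replicate (α i) i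

/-- `∂^α γ = ∂₁^{α₁} (⋯ (∂_d^{α_d} γ))`. -/
def partialDeriv (α : Fin d → ℕ) (γ : Ω → F) : Ω → F :=
  wordDeriv (indexWord α) γ

/-- `γ` is `C^ℓ`: for all multi-indices with `|α| ≤ ℓ`, the partial derivative `∂^α γ` exists on `Ω`
and is continuous (in particular, `γ` is continuous, as `α = 0` is included). -/
def IsCk (ℓ : ℕ∞) (γ : Ω → F) : Prop :=
  ∀ α : Fin d → ℕ, ((∑ i, α i : ℕ) : ℕ∞) ≤ ℓ →
    WordDerivExists (indexWord α) γ ∧ Continuous (partialDeriv α γ)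

lemma HasPartialAt.pderiv_eq [T2Space F] {i : Fin d} {γ : Ω → F} {x : Ω} {v : F}
    (h : HasPartialAt i γ x v) : pderiv i γ x = v := by
  have hex : ∃ v, HasPartialAt i γ x v := ⟨v, h⟩
  rw [pderiv, dif_pos hex]
  exact tendsto_nhds_unique hex.choose_spec h

lemma diffQuot_eq {G : Type*} [AddCommGroup G] [Module ℝ G] (L : G →ₗ[ℝ] F)
    (i : Fin d) (γ : Ω → G) (x : Ω) (t : ℝ) :
    diffQuot i (fun y => L (γ y)) x t = L (diffQuot i γ x t) := by
  have h : ∀ y, Function.extend (Subtype.val : Ω → (Fin d → ℝ)) (fun y => L (γ y)) 0 y =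
      L (Function.extend (Subtype.val : Ω → (Fin d → ℝ)) γ 0 y) := by
    intro y
    by_cases hy : ∃ z : Ω, (z : Fin d → ℝ) = y
    · obtain ⟨z, rfl⟩ := hy
      simp
    · rw [Function.extend_apply' _ _ _ hy, Function.extend_apply' _ _ _ hy]
      simp
  simp [diffQuot, h]

lemma diffQuot_add (i : Fin d) (γ η : Ω → F) (x : Ω) (t : ℝ) :
    diffQuot i (γ + η) x t = diffQuot i γ x t + diffQuot i η x t := by
  have h := Function.extend_add (Subtype.val : Ω → (Fin d → ℝ)) γ η (0 : (Fin d → ℝ) → F) 0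
  rw [add_zero] at h
  simp only [diffQuot, h, Pi.add_apply, ← smul_add]
  congr 1
  abel

/-- Partial derivatives commute with continuous linear maps applied to the values. -/
lemma wordDeriv_comp {G : Type*} [AddCommGroup G] [Module ℝ G] [TopologicalSpace G]
    [T2Space G] [T2Space F] (L : G →L[ℝ] F) {γ : Ω → G} :
    ∀ w : List (Fin d), WordDerivExists w γ →
      WordDerivExists w (fun y => L (γ y)) ∧
        wordDeriv w (fun y => L (γ y)) = fun y => L (wordDeriv w γ y)
  | [], _ => ⟨trivial, rfl⟩
  | i :: w, h => by
    obtain ⟨h1, h2⟩ := wordDeriv_comp L w h.1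
    have key : ∀ x v, HasPartialAt i (wordDeriv w γ) x v →
        HasPartialAt i (wordDeriv w (fun y => L (γ y))) x (L v) := by
      intro x v hv
      have := (L.continuous.tendsto v).comp hv
      rw [HasPartialAt, h2]
      refine this.congr fun t => ?_
      exact (diffQuot_eq (L : G →ₗ[ℝ] F) i _ x t).symm
    refine ⟨⟨h1, fun x => ?_⟩, funext fun x => ?_⟩
    · obtain ⟨v, hv⟩ := h.2 x
      exact ⟨_, key x v hv⟩
    · obtain ⟨v, hv⟩ := h.2 x
      simp only [wordDeriv]
      rw [(key x v hv).pderiv_eq, hv.pderiv_eq]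

lemma wordDeriv_add [IsTopologicalAddGroup F] [T2Space F] {γ η : Ω → F} :
    ∀ w : List (Fin d), WordDerivExists w γ → WordDerivExists w η →
      WordDerivExists w (γ + η) ∧ wordDeriv w (γ + η) = wordDeriv w γ + wordDeriv w η
  | [], _, _ => ⟨trivial, rfl⟩
  | i :: w, h, k => by
    obtain ⟨h1, h2⟩ := wordDeriv_add w h.1 k.1
    have key : ∀ x u v, HasPartialAt i (wordDeriv w γ) x u → HasPartialAt i (wordDeriv w η) x v →
        HasPartialAt i (wordDeriv w (γ + η)) x (u + v) := by
      intro x u v hu hv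
      have := hu.add hv
      rw [HasPartialAt, h2]
      exact this.congr fun t => (diffQuot_add i _ _ x t).symm
    refine ⟨⟨h1, fun x => ?_⟩, funext fun x => ?_⟩
    · obtain ⟨u, hu⟩ := h.2 x
      obtain ⟨v, hv⟩ := k.2 x
      exact ⟨_, key x u v hu hv⟩
    · obtain ⟨u, hu⟩ := h.2 x
      obtain ⟨v, hv⟩ := k.2 x
      simp only [wordDeriv, Pi.add_apply]
      rw [(key x u v hu hv).pderiv_eq, hu.pderiv_eq, hv.pderiv_eq]

lemma IsCk.comp {G : Type*} [AddCommGroup G] [Module ℝ G] [TopologicalSpace G]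
    [T2Space G] [T2Space F] {ℓ : ℕ∞} (L : G →L[ℝ] F) {γ : Ω → G} (h : IsCk ℓ γ) :
    IsCk ℓ (fun y => L (γ y)) := fun α hα => by
  obtain ⟨h1, h2⟩ := wordDeriv_comp L _ (h α hα).1
  refine ⟨h1, ?_⟩
  rw [partialDeriv, h2]
  exact L.continuous.comp (h α hα).2

lemma IsCk.mono {k ℓ : ℕ∞} (hk : k ≤ ℓ) {γ : Ω → F} (h : IsCk ℓ γ) : IsCk k γ :=
  fun α hα => h α (hα.trans hk)

lemma IsCk.add [IsTopologicalAddGroup F] [T2Space F] {ℓ : ℕ∞} {γ η : Ω → F}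
    (h : IsCk ℓ γ) (k : IsCk ℓ η) : IsCk ℓ (γ + η) := fun α hα => by
  obtain ⟨h1, h2⟩ := wordDeriv_add _ (h α hα).1 (k α hα).1
  refine ⟨h1, ?_⟩
  rw [partialDeriv, h2]
  exact (h α hα).2.add (k α hα).2

variable [IsTopologicalAddGroup F] [ContinuousSMul ℝ F] [T2Space F]

lemma IsCk.smul {ℓ : ℕ∞} (c : ℝ) {γ : Ω → F} (h : IsCk ℓ γ) : IsCk ℓ (c • γ) :=
  h.comp (c • ContinuousLinearMap.id ℝ F)

lemma IsCk.smul_const {ℓ : ℕ∞} {η : Ω → ℝ} (h : IsCk ℓ η) (v : F) :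
    IsCk ℓ (fun x => η x • v) :=
  h.comp (ContinuousLinearMap.toSpanSingleton ℝ v)

lemma isCk_zero (ℓ : ℕ∞) : IsCk ℓ (0 : Ω → F) := by
  have hw : ∀ w : List (Fin d), WordDerivExists w (0 : Ω → F) ∧ wordDeriv w (0 : Ω → F) = 0 := by
    intro w
    induction w with
    | nil => exact ⟨trivial, rfl⟩
    | cons i w ih =>
      have key : ∀ x : Ω, HasPartialAt i (wordDeriv w (0 : Ω → F)) x 0 := by
        intro x
        have h0 : diffQuot i (0 : Ω → F) x = fun _ => 0 := by
          funext t
          exact diffQuot_eq (0 : F →ₗ[ℝ] F) i (0 : Ω → F) x t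
        rw [HasPartialAt, ih.2, h0]
        exact tendsto_const_nhds
      exact ⟨⟨ih.1, fun x => ⟨0, key x⟩⟩, funext fun x => (key x).pderiv_eq⟩
  intro α _
  refine ⟨(hw _).1, ?_⟩
  rw [partialDeriv, (hw _).2]
  exact continuous_zero

end VectorCk

open VectorCk

section Spaces

variable {d : ℕ} (ℓ : ℕ∞) (Ω : TopologicalSpace.Opens (Fin d → ℝ))
  (F : Type*) [AddCommGroup F] [Module ℝ F] [TopologicalSpace F]
  [IsTopologicalAddGroup F] [ContinuousSMul ℝ F] [T2Space F]

/-- The `C^ℓ`-functions `Ω → F` as a vector subspace of all functions. -/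
def ckSubmodule : Submodule ℝ (Ω → F) where
  carrier := {γ | IsCk ℓ γ}
  add_mem' := IsCk.add
  zero_mem' := isCk_zero ℓ
  smul_mem' c _ h := h.smul c

/-- The vector space `C^ℓ(Ω, F)`, for `ℓ ∈ ℕ₀ ∪ {∞}`. Its topology is *not* the one of pointwise
convergence but the compact-open `C^ℓ`-topology defined below. -/
def CkSpace : Type _ := ckSubmodule ℓ Ω F

instance : AddCommGroup (CkSpace ℓ Ω F) := inferInstanceAs (AddCommGroup (ckSubmodule ℓ Ω F))

instance : Module ℝ (CkSpace ℓ Ω F) := inferInstanceAs (Module ℝ (ckSubmodule ℓ Ω F))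

instance : CoeFun (CkSpace ℓ Ω F) (fun _ => Ω → F) := ⟨fun γ => γ.1⟩

variable {ℓ Ω F}

namespace CkSpace

/-- The map `∂^α : C^ℓ(Ω, F) → C(Ω, F)`, for `|α| ≤ ℓ`. -/
def partialMap (α : Fin d → ℕ) (hα : ((∑ i, α i : ℕ) : ℕ∞) ≤ ℓ) (γ : CkSpace ℓ Ω F) : C(Ω, F) :=
  ⟨partialDeriv α γ, (γ.2 α hα).2⟩

/-- The compact-open `C^ℓ`-topology: the initial topology with respect to the maps
`∂^α : C^ℓ(Ω, F) → C(Ω, F)` for `|α| ≤ ℓ`, where `C(Ω, F)` has the compact-open topology. -/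
instance : TopologicalSpace (CkSpace ℓ Ω F) :=
  ⨅ (α : Fin d → ℕ) (hα : ((∑ i, α i : ℕ) : ℕ∞) ≤ ℓ),
    TopologicalSpace.induced (partialMap α hα) ContinuousMap.compactOpen

/-- The inclusion `C^ℓ(Ω, F) → C^k(Ω, F)` for `k ≤ ℓ`. -/
def incl {k : ℕ∞} (hk : k ≤ ℓ) : CkSpace ℓ Ω F →ₗ[ℝ] CkSpace k Ω F where
  toFun γ := ⟨γ.1, IsCk.mono hk γ.2⟩
  map_add' _ _ := rfl
  map_smul' _ _ := rfl

variable (ℓ F) in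
/-- The space `C^ℓ_K(Ω, F)` of all `γ ∈ C^ℓ(Ω, F)` whose support (closure in `Ω` of the set where
`γ` is nonzero) is contained in the closed (usually compact) set `K`. -/
def suppIn (K : Set Ω) : Submodule ℝ (CkSpace ℓ Ω F) where
  carrier := {γ | tsupport (γ : Ω → F) ⊆ K}
  add_mem' {γ η} hγ hη := (tsupport_add (γ : Ω → F) (η : Ω → F)).trans (Set.union_subset hγ hη)
  zero_mem' := by
    change tsupport (0 : Ω → F) ⊆ K
    simp [tsupport]
  smul_mem' c γ hγ :=
    (closure_mono (Function.support_const_smul_subset c (γ : Ω → F))).trans hγ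

/-- The function `x ↦ η(x) v`, bilinear in `v ∈ F` and `η ∈ C^ℓ(Ω, ℝ)`. -/
def smulVec : F →ₗ[ℝ] CkSpace ℓ Ω ℝ →ₗ[ℝ] CkSpace ℓ Ω F :=
  LinearMap.mk₂ ℝ (fun v η => ⟨fun x => (η : Ω → ℝ) x • v, IsCk.smul_const η.2 v⟩)
    (fun v w η => Subtype.ext (funext fun x => smul_add ((η : Ω → ℝ) x) v w))
    (fun c v η => Subtype.ext (funext fun x => smul_comm ((η : Ω → ℝ) x) c v))
    (fun v η ξ => Subtype.ext (funext fun x => add_smul ((η : Ω → ℝ) x) ((ξ : Ω → ℝ) x) v))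
    (fun c v η => Subtype.ext (funext fun x => mul_smul c ((η : Ω → ℝ) x) v))

variable (ℓ F) in
/-- `F ⊗ C^ℓ_K(Ω, ℝ)`, regarded as a vector subspace of `C^ℓ(Ω, F)`: the image of the linear map
determined by `v ⊗ η ↦ (x ↦ η(x) v)`. -/
def tensorSuppIn (K : Set Ω) : Submodule ℝ (CkSpace ℓ Ω F) :=
  LinearMap.range
    (TensorProduct.lift (smulVec.compl₂ (suppIn ℓ ℝ K).subtype) :
      F ⊗[ℝ] (suppIn ℓ ℝ K) →ₗ[ℝ] CkSpace ℓ Ω F)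

end CkSpace

end Spaces

end CkDefs

/-!
The approximating operators are quasi-interpolants: for a mesh size `h` and a compact set `K`,
`S γ (x) = ∑_j φ (x / h - j) γ (h j)`, where `j` runs through the points of the integer lattice with
`h j ∈ K`, and `φ (x) = ∏ᵢ b_ℓ (xᵢ)`. Here `b_0` is a smooth bump whose integer translates sum to `1`
and `b_{k+1} (x) = ∫_x^{x+1} b_k`. Only finitely many values of `γ` enter, so no completeness of `F`
is needed, and `S` is continuous with values in `F ⊗ C^∞` (`CkSpace.samplingCLM`). The supports of
the summands have diameter of order `h`, so the support conditions hold as soon as `h` is small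
compared with the gaps of the exhaustion (`CompactExhaustion.exists_meshSize`).

For the convergence, `b_{k+1}' (x) = b_k (x + 1) - b_k x`, and summation by parts moves each such
difference to the coefficients. Hence for a word `w` of length at most `ℓ`, the derivative of `S γ`
along `w` is `∑_j φ_w (x / h - j) (h^{-|w|} Δ_w γ) (h j)`, where `Δ_w` is an iterated forward
difference with step `h` and the `φ_w` are kernels of lower order which are still nonnegative and
whose translates still sum to `1` (`VectorCk.wordDeriv_splineSum`). By the iterated mean value
theorem, applied to `f ∘ γ` for continuous linear functionals `f`, and the Hahn-Banach theorem,
`h^{-|w|} Δ_w γ (h j)` lies in every closed convex set that contains the values of `∂_w γ` near `h j`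
(`VectorCk.WordDerivExists.wordDiff_mem`). So `∂_w (S γ) (x)` lies in every closed convex set that
contains `∂_w γ` near `x` (`CkSpace.partialDeriv_splineCLM_mem`), and the uniform continuity of
`∂_w γ` on compact sets gives the convergence. The differences are taken in the same order as the
derivatives, so that the symmetry of mixed partial derivatives is not used.
-/

/-! ### Smoothed B-splines on the line -/

/-- The `k`-fold convolution power of the indicator function of `[-1, 0]`, convolved with the smooth
bump `x ↦ s (x + 1) - s x` for a smooth step `s`: a smooth version of the cardinal B-spline. -/
noncomputable def smoothSpline : ℕ → ℝ → ℝ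
  | 0, x => Real.smoothTransition (x + 1) - Real.smoothTransition x
  | k + 1, x => ∫ t in x..(x + 1), smoothSpline k t

namespace smoothSpline

theorem hasDerivAt_succ_of_continuous {k : ℕ} (h : Continuous (smoothSpline k)) (x : ℝ) :
    HasDerivAt (smoothSpline (k + 1)) (smoothSpline k (x + 1) - smoothSpline k x) x := by
  have hi : ∀ a b, IntervalIntegrable (smoothSpline k) MeasureTheory.volume a b :=
    fun a b => h.intervalIntegrable a b
  have h0 : ∀ y, HasDerivAt (fun y => ∫ t in (0 : ℝ)..y, smoothSpline k t) (smoothSpline k y) y :=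
    fun y => h.integral_hasStrictDerivAt 0 y |>.hasDerivAt
  have h1 := ((h0 (x + 1)).comp_add_const x 1).sub (h0 x)
  refine h1.congr_of_eventuallyEq (Eventually.of_forall fun y => ?_)
  simp only [smoothSpline, Pi.sub_apply]
  rw [intervalIntegral.integral_interval_sub_left (hi _ _) (hi _ _)]

theorem contDiff (k : ℕ) : ContDiff ℝ (⊤ : ℕ∞) (smoothSpline k) := by
  induction k with
  | zero =>
    exact (Real.smoothTransition.contDiff.comp (contDiff_id.add contDiff_const)).sub
      Real.smoothTransition.contDiff
  | succ k ih =>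
    have hd := hasDerivAt_succ_of_continuous ih.continuous
    rw [contDiff_infty_iff_deriv]
    refine ⟨fun x => (hd x).differentiableAt, ?_⟩
    rw [funext fun x => (hd x).deriv]
    exact (ih.comp (contDiff_id.add contDiff_const)).sub ih

theorem continuous (k : ℕ) : Continuous (smoothSpline k) := (contDiff k).continuous

theorem hasDerivAt_succ (k : ℕ) (x : ℝ) :
    HasDerivAt (smoothSpline (k + 1)) (smoothSpline k (x + 1) - smoothSpline k x) x :=
  hasDerivAt_succ_of_continuous (continuous k) x

theorem nonneg (k : ℕ) (x : ℝ) : 0 ≤ smoothSpline k x := by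
  induction k generalizing x with
  | zero => exact sub_nonneg.2 (Real.smoothTransition.monotone (by linarith))
  | succ k ih => exact intervalIntegral.integral_nonneg (by linarith) fun t _ => ih t

theorem abs_le_of_ne_zero {k : ℕ} {x : ℝ} (h : smoothSpline k x ≠ 0) : |x| ≤ k + 1 := by
  induction k generalizing x with
  | zero =>
    contrapose! h
    simp only [smoothSpline]
    rcases lt_abs.1 h with h | h <;> norm_num at h
    · rw [Real.smoothTransition.one_of_one_le (by linarith),
        Real.smoothTransition.one_of_one_le h.le, sub_self]
    · rw [Real.smoothTransition.zero_of_nonpos (by linarith),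
        Real.smoothTransition.zero_of_nonpos (by linarith), sub_self]
  | succ k ih =>
    contrapose! h
    have h0 : ∀ t ∈ Set.uIcc x (x + 1), smoothSpline k t = 0 := by
      intro t ht
      rw [Set.uIcc_of_le (by linarith)] at ht
      by_contra hne
      have h1 := ih hne
      have h2 : |t - x| ≤ 1 := abs_le.2 ⟨by linarith [ht.1], by linarith [ht.2]⟩
      have h3 := abs_sub_abs_le_abs_sub x t
      rw [abs_sub_comm] at h3
      push_cast at h
      linarith
    simp only [smoothSpline]
    rw [intervalIntegral.integral_congr h0, intervalIntegral.integral_zero]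

/-- The integer translates of a smooth spline form a partition of unity. -/
theorem sum_translates (k : ℕ) {x : ℝ} {N : ℕ} (h : |x| + k + 1 ≤ N) :
    ∑ j ∈ Finset.Icc (-(N : ℤ)) N, smoothSpline k (x - j) = 1 := by
  induction k generalizing x with
  | zero =>
    -- the sum telescopes
    have key : ∀ M : ℕ, ∑ j ∈ Finset.Icc (-(M : ℤ)) M, smoothSpline 0 (x - j) =
        Real.smoothTransition (x + M + 1) - Real.smoothTransition (x - M) := by
      intro M
      induction M with
      | zero => simp [smoothSpline]
      | succ M ih =>
        have hs : Finset.Icc (-((M + 1 : ℕ) : ℤ)) ((M + 1 : ℕ) : ℤ) =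
            insert (-((M + 1 : ℕ) : ℤ)) (insert ((M + 1 : ℕ) : ℤ) (Finset.Icc (-(M : ℤ)) M)) := by
          ext j
          simp only [Finset.mem_Icc, Finset.mem_insert]
          omega
        rw [hs, Finset.sum_insert (by simp; omega), Finset.sum_insert (by simp), ih]
        simp only [smoothSpline]
        push_cast
        ring_nf
    have h1 := neg_abs_le x
    have h2 := le_abs_self x
    push_cast at h
    rw [key, Real.smoothTransition.one_of_one_le (by linarith),
      Real.smoothTransition.zero_of_nonpos (by linarith), sub_zero]
  | succ k ih =>
    have h1 : ∀ j : ℤ, smoothSpline (k + 1) (x - j) =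
        ∫ t in (0 : ℝ)..1, smoothSpline k (x + t - j) := by
      intro j
      have := intervalIntegral.integral_comp_add_left (a := 0) (b := 1) (smoothSpline k) (x - j)
      simp only [smoothSpline]
      rw [add_zero] at this
      rw [← this]
      simp only [sub_add_eq_add_sub]
    simp_rw [h1]
    have hc : ∀ j : ℤ, Continuous fun t : ℝ => smoothSpline k (x + t - j) :=
      fun j => (continuous k).comp (by fun_prop)
    rw [← intervalIntegral.integral_finsetSum fun j _ => (hc j).intervalIntegrable _ _]
    have h2 : Set.EqOn (fun t : ℝ => ∑ j ∈ Finset.Icc (-(N : ℤ)) N, smoothSpline k (x + t - j))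
        (fun _ => 1) (Set.uIcc 0 1) := by
      intro t ht
      rw [Set.uIcc_of_le zero_le_one] at ht
      refine ih ?_
      have := abs_add_le x t
      rw [abs_of_nonneg ht.1] at this
      push_cast at h
      linarith [ht.2]
    rw [intervalIntegral.integral_congr h2]
    simp

end smoothSpline

/-! ### Tensor product kernels on the lattice -/

/-- The tensor product of the smooth splines of orders `k i` in the variables `x i`. -/
noncomputable def splineKernel {d : ℕ} (k : Fin d → ℕ) (x : Fin d → ℝ) : ℝ :=
  ∏ i, smoothSpline (k i) (x i)

/-- The real vector with integer coordinates `j`. -/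
def latticePoint {d : ℕ} (j : Fin d → ℤ) : Fin d → ℝ := fun i => j i

namespace splineKernel

variable {d : ℕ}

theorem contDiff (k : Fin d → ℕ) : ContDiff ℝ (⊤ : ℕ∞) (splineKernel k) :=
  contDiff_prod fun i _ => (smoothSpline.contDiff (k i)).comp (contDiff_apply ℝ ℝ i)

theorem nonneg (k : Fin d → ℕ) (x : Fin d → ℝ) : 0 ≤ splineKernel k x :=
  Finset.prod_nonneg fun i _ => smoothSpline.nonneg (k i) (x i)

theorem norm_le_of_ne_zero {k : Fin d → ℕ} {ℓ : ℕ} (hk : ∀ i, k i ≤ ℓ) {x : Fin d → ℝ}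
    (h : splineKernel k x ≠ 0) : ‖x‖ ≤ ℓ + 1 := by
  refine (pi_norm_le_iff_of_nonneg (by positivity)).2 fun i => ?_
  have h1 := smoothSpline.abs_le_of_ne_zero (Finset.prod_ne_zero_iff.1 h i (Finset.mem_univ i))
  have h2 : (k i : ℝ) ≤ ℓ := by exact_mod_cast hk i
  rw [Real.norm_eq_abs]
  linarith

theorem finsum_translates (k : Fin d → ℕ) (x : Fin d → ℝ) :
    ∑ᶠ j : Fin d → ℤ, splineKernel k (x - latticePoint j) = 1 := by
  obtain ⟨N, hN⟩ : ∃ N : ℕ, ∀ i, |x i| + k i + 1 ≤ N := by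
    obtain ⟨N, hN⟩ := exists_nat_ge (∑ i, (|x i| + k i + 1))
    refine ⟨N, fun i => le_trans ?_ hN⟩
    exact Finset.single_le_sum (f := fun i => |x i| + k i + 1) (fun i _ => by positivity)
      (Finset.mem_univ i)
  rw [finsum_eq_sum_of_support_subset (s := Fintype.piFinset fun _ => Finset.Icc (-(N : ℤ)) N)]
  · have h := Finset.prod_univ_sum (fun _ : Fin d => Finset.Icc (-(N : ℤ)) N)
      (fun i j => smoothSpline (k i) (x i - j))
    rw [Finset.prod_congr rfl fun i _ => smoothSpline.sum_translates (k i) (hN i),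
      Finset.prod_const_one] at h
    exact h.symm
  · intro j hj
    simp only [Finset.mem_coe, Fintype.mem_piFinset, Finset.mem_Icc]
    intro i
    have h1 := smoothSpline.abs_le_of_ne_zero
      (Finset.prod_ne_zero_iff.1 hj i (Finset.mem_univ i))
    have h2 := abs_le.1 h1
    have h3 := hN i
    have h4 := le_abs_self (x i)
    have h5 := neg_abs_le (x i)
    simp only [Pi.sub_apply, latticePoint] at h2
    constructor
    · have : (-(N : ℝ)) ≤ j i := by linarith
      exact_mod_cast this
    · have : (j i : ℝ) ≤ N := by linarith
      exact_mod_cast this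

/-- The partial derivative of a kernel is a unit difference of the kernel whose order is lower by
one in the variable of differentiation. -/
theorem hasLineDerivAt {k k' : Fin d → ℕ} {i : Fin d} (hi : k i = k' i + 1)
    (hne : ∀ m, m ≠ i → k m = k' m) (x : Fin d → ℝ) :
    HasLineDerivAt ℝ (splineKernel k)
      (splineKernel k' (x + Pi.single i 1) - splineKernel k' x) x (Pi.single i 1) := by
  classical
  set P := ∏ m ∈ Finset.univ.erase i, smoothSpline (k' m) (x m) with hP
  have h1 : ∀ t : ℝ, splineKernel k (x + t • Pi.single i 1) =
      smoothSpline (k' i + 1) (x i + t) * P := by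
    intro t
    rw [splineKernel, ← Finset.mul_prod_erase _ _ (Finset.mem_univ i), hi]
    congr 1
    · simp
    · refine Finset.prod_congr rfl fun m hm => ?_
      have := Finset.ne_of_mem_erase hm
      simp [hne m this, this]
  have h2 : ∀ t : ℝ, splineKernel k' (x + t • Pi.single i 1) =
      smoothSpline (k' i) (x i + t) * P := by
    intro t
    rw [splineKernel, ← Finset.mul_prod_erase _ _ (Finset.mem_univ i)]
    congr 1
    · simp
    · refine Finset.prod_congr rfl fun m hm => ?_
      have := Finset.ne_of_mem_erase hm
      simp [this]
  have h3 := h2 1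
  have h4 := h2 0
  rw [one_smul] at h3
  rw [zero_smul, add_zero, add_zero] at h4
  rw [HasLineDerivAt, funext h1, h3, h4, ← sub_mul]
  refine HasDerivAt.mul_const ?_ P
  have := smoothSpline.hasDerivAt_succ (k' i) (x i + 0)
  have h5 := this.comp_const_add (x i) 0
  simpa using h5

end splineKernel

/-! ### Iterated forward differences and the mean value theorem -/

/-- The iterated forward difference `Δ_{i₁} (Δ_{i₂} (⋯ Δ_{iₖ} c))` along a word `[i₁, …, iₖ]`, where
`Δ_i` has step `h` in the direction of the `i`-th coordinate. -/
def wordDiff {d : ℕ} {F : Type*} [AddCommGroup F] (h : ℝ) :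
    List (Fin d) → ((Fin d → ℝ) → F) → (Fin d → ℝ) → F
  | [], c => c
  | i :: w, c => fwdDiff (h • Pi.single i 1) (wordDiff h w c)

section wordDiff

variable {d : ℕ} {F : Type*} [AddCommGroup F] {h : ℝ}

theorem wordDiff_fwdDiff (v : Fin d → ℝ) (w : List (Fin d)) (c : (Fin d → ℝ) → F) :
    wordDiff h w (fwdDiff v c) = fwdDiff v (wordDiff h w c) := by
  induction w with
  | nil => rfl
  | cons i w ih =>
    simp only [wordDiff, ih]
    funext x
    simp only [fwdDiff, add_right_comm x v]
    abel

theorem map_wordDiff {G : Type*} [AddCommGroup G] (f : F →+ G) (w : List (Fin d))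
    (c : (Fin d → ℝ) → F) (x : Fin d → ℝ) :
    f (wordDiff h w c x) = wordDiff h w (fun y => f (c y)) x := by
  induction w generalizing x with
  | nil => rfl
  | cons i w ih => simp only [wordDiff, fwdDiff, map_sub, ih]

theorem Bornology.IsBounded.support_fwdDiff {c : (Fin d → ℝ) → F}
    (hc : Bornology.IsBounded (Function.support c)) (v : Fin d → ℝ) :
    Bornology.IsBounded (Function.support (fwdDiff v c)) := by
  obtain ⟨r, hr⟩ := isBounded_iff_forall_norm_le.1 hc
  refine isBounded_iff_forall_norm_le.2 ⟨r + ‖v‖, fun x hx => ?_⟩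
  by_cases h1 : c x = 0
  · have h2 : c (x + v) ≠ 0 := by
      intro h2
      simp [fwdDiff, h1, h2] at hx
    have h3 := hr _ h2
    have h4 := norm_sub_le (x + v) v
    rw [add_sub_cancel_right] at h4
    linarith
  · linarith [hr x h1, norm_nonneg v]

theorem Bornology.IsBounded.support_wordDiff {c : (Fin d → ℝ) → F}
    (hc : Bornology.IsBounded (Function.support c)) (w : List (Fin d)) :
    Bornology.IsBounded (Function.support (wordDiff h w c)) := by
  induction w with
  | nil => exact hc
  | cons i w ih => exact ih.support_fwdDiff _

end wordDiff

/-- `HasWordLineDeriv w g g' U` means that `g'` is obtained on `U` from the real-valued function `g`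
by taking partial derivatives along the word `w`. The functions are defined on the whole space, but
nothing is required of them outside `U`. -/
def HasWordLineDeriv {d : ℕ} :
    List (Fin d) → ((Fin d → ℝ) → ℝ) → ((Fin d → ℝ) → ℝ) → Set (Fin d → ℝ) → Prop
  | [], g, g', U => Set.EqOn g g' U
  | i :: w, g, g', U => ∃ f, HasWordLineDeriv w g f U ∧
      ∀ x ∈ U, HasLineDerivAt ℝ f (g' x) x (Pi.single i 1)

namespace HasWordLineDeriv

variable {d : ℕ} {w : List (Fin d)} {g g' : (Fin d → ℝ) → ℝ} {U : Set (Fin d → ℝ)}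

theorem fwdDiff (hg : HasWordLineDeriv w g g' U) (v : Fin d → ℝ) :
    HasWordLineDeriv w (fwdDiff v g) (fwdDiff v g') {x | x ∈ U ∧ x + v ∈ U} := by
  induction w generalizing g' with
  | nil => exact fun x hx => by simp only [_root_.fwdDiff, hg hx.1, hg hx.2]
  | cons i w ih =>
    obtain ⟨f, h1, h2⟩ := hg
    refine ⟨_, ih h1, fun x hx => ?_⟩
    have := (h2 _ hx.2).sub (h2 _ hx.1)
    simp only [HasLineDerivAt, _root_.fwdDiff] at this ⊢
    simpa only [add_right_comm x v, Pi.sub_def] using this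

/-- Iterated mean value theorem: an iterated difference quotient equals the corresponding partial
derivative at a nearby point. -/
theorem exists_wordDiff_eq {h : ℝ} (hh : 0 < h) (hg : HasWordLineDeriv w g g' U)
    {y : Fin d → ℝ} (hU : Metric.closedBall y (w.length * h) ⊆ U) :
    ∃ z ∈ Metric.closedBall y (w.length * h), wordDiff h w g y = h ^ w.length * g' z := by
  induction w generalizing g g' U with
  | nil =>
    have hy : y ∈ Metric.closedBall y (([] : List (Fin d)).length * h) := by simp
    exact ⟨y, hy, by simpa [wordDiff] using hg (hU hy)⟩
  | cons i w ih =>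
    obtain ⟨f, h1, h2⟩ := hg
    set e : Fin d → ℝ := Pi.single i 1 with he
    have hne : ‖e‖ = 1 := by rw [he, Pi.norm_single, norm_one]
    have hmem : ∀ z ∈ Metric.closedBall y (w.length * h), ∀ t ∈ Set.Icc 0 h,
        z + t • e ∈ Metric.closedBall y ((i :: w).length * h) := by
      intro z hz t ht
      rw [mem_closedBall_iff_norm] at hz ⊢
      have h3 : z + t • e - y = (z - y) + t • e := by abel
      have h4 := norm_add_le (z - y) (t • e)
      rw [norm_smul, hne, mul_one, Real.norm_of_nonneg ht.1] at h4
      rw [h3, List.length_cons]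
      push_cast
      linarith [ht.2]
    have h0 : ∀ z ∈ Metric.closedBall y (w.length * h),
        z ∈ Metric.closedBall y ((i :: w).length * h) := fun z hz => by
      simpa using hmem z hz 0 ⟨le_rfl, hh.le⟩
    obtain ⟨z, hz, hzeq⟩ := ih (h1.fwdDiff (h • e)) fun z hz =>
      ⟨hU (h0 z hz), hU (hmem z hz h ⟨hh.le, le_rfl⟩)⟩
    have hder : ∀ t ∈ Set.Icc 0 h, HasDerivAt (fun s : ℝ => f (z + s • e)) (g' (z + t • e)) t := by
      intro t ht
      have h3 := h2 _ (hU (hmem z hz t ht))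
      rw [HasLineDerivAt] at h3
      have h4 : HasDerivAt (fun s : ℝ => f (z + t • e + s • e)) (g' (z + t • e)) (t - t) := by
        rwa [sub_self]
      have h5 := h4.comp_sub_const t t
      refine h5.congr_of_eventuallyEq (Eventually.of_forall fun s => ?_)
      simp only [add_assoc, ← add_smul]
      congr 4
      ring
    obtain ⟨t, ht, hteq⟩ := exists_hasDerivAt_eq_slope (fun s : ℝ => f (z + s • e))
      (fun s => g' (z + s • e)) hh
      (fun t ht => (hder t ht).continuousAt.continuousWithinAt)
      (fun t ht => hder t (Set.Ioo_subset_Icc_self ht))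
    refine ⟨z + t • e, hmem z hz t (Set.Ioo_subset_Icc_self ht), ?_⟩
    rw [wordDiff, ← wordDiff_fwdDiff, hzeq, hteq, List.length_cons, pow_succ]
    simp only [_root_.fwdDiff, zero_smul, add_zero, sub_zero]
    field_simp

end HasWordLineDeriv

namespace VectorCk

variable {d : ℕ} {Ω : TopologicalSpace.Opens (Fin d → ℝ)}

theorem extend_coe {F : Type*} [Zero F] (γ : Ω → F) (x : Ω) :
    Function.extend (Subtype.val : Ω → Fin d → ℝ) γ 0 x = γ x :=
  Subtype.val_injective.extend_apply _ _ _

variable {F : Type*} [AddCommGroup F] [Module ℝ F] [TopologicalSpace F]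

/-- After applying a continuous linear functional, the iterated partial derivatives of a vector
valued function become iterated line derivatives. -/
theorem WordDerivExists.hasWordLineDeriv [T2Space F] (f : StrongDual ℝ F) {γ : Ω → F}
    {c : (Fin d → ℝ) → F} {U : Set (Fin d → ℝ)} (hU : U ⊆ Ω) (hc : ∀ x : Ω, ↑x ∈ U → c x = γ x)
    {w : List (Fin d)} (hw : WordDerivExists w γ) :
    HasWordLineDeriv w (fun x => f (c x))
      (fun x => f (Function.extend (Subtype.val : Ω → Fin d → ℝ) (wordDeriv w γ) 0 x)) U := by
  induction w with
  | nil =>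
    intro x hx
    lift x to Ω using hU hx
    simp only [wordDeriv, extend_coe, hc x hx]
  | cons i w ih =>
    refine ⟨_, ih hw.1, fun x hx => ?_⟩
    lift x to Ω using hU hx
    obtain ⟨v, hv⟩ := hw.2 x
    simp only [hasLineDerivAt_iff_tendsto_slope_zero, extend_coe, wordDeriv, hv.pderiv_eq]
    refine ((f.continuous.tendsto v).comp hv).congr fun t => ?_
    simp only [Function.comp, diffQuot, map_smul, map_sub]

/-- The difference quotients of `γ` lie in every closed convex set that contains the corresponding
partial derivative at all nearby points. -/
theorem WordDerivExists.wordDiff_mem [IsTopologicalAddGroup F] [ContinuousSMul ℝ F]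
    [LocallyConvexSpace ℝ F] [T2Space F] {γ : Ω → F} {c : (Fin d → ℝ) → F}
    {w : List (Fin d)} (hw : WordDerivExists w γ) {h : ℝ} (hh : 0 < h) {y : Fin d → ℝ}
    (hU : Metric.closedBall y (w.length * h) ⊆ Ω)
    (hc : ∀ x : Ω, ↑x ∈ Metric.closedBall y (w.length * h) → c x = γ x)
    {A : Set F} (hA : Convex ℝ A) (hA' : IsClosed A)
    (hmem : ∀ x : Ω, ↑x ∈ Metric.closedBall y (w.length * h) → wordDeriv w γ x ∈ A) :
    (h⁻¹) ^ w.length • wordDiff h w c y ∈ A := by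
  by_contra hn
  -- a separating functional reduces the claim to the scalar mean value theorem
  obtain ⟨f, u, h1, h2⟩ := geometric_hahn_banach_closed_point hA hA' hn
  obtain ⟨z, hz, hzeq⟩ := (hw.hasWordLineDeriv f hU hc).exists_wordDiff_eq hh subset_rfl
  have h3 : f (wordDiff h w c y) = wordDiff h w (fun x => f (c x)) y :=
    map_wordDiff (f : F →+ ℝ) w c y
  have hz' := hz
  lift z to Ω using hU hz
  have h4 := h1 _ (hmem z hz')
  rw [map_smul, h3, hzeq, extend_coe, smul_eq_mul, ← mul_assoc, ← mul_pow,
    inv_mul_cancel₀ hh.ne', one_pow, one_mul] at h2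
  linarith

end VectorCk

/-! ### Spline sums and their derivatives -/

theorem finite_setOf_latticePoint_mem {d : ℕ} {h : ℝ} (hh : 0 < h) {A : Set (Fin d → ℝ)}
    (hA : Bornology.IsBounded A) : {j : Fin d → ℤ | h • latticePoint j ∈ A}.Finite := by
  obtain ⟨r, hr⟩ := isBounded_iff_forall_norm_le.1 hA
  obtain ⟨N, hN⟩ := exists_nat_ge (h⁻¹ * r)
  refine (Fintype.piFinset fun _ : Fin d => Finset.Icc (-(N : ℤ)) N).finite_toSet.subset ?_
  intro j hj
  simp only [Finset.mem_coe, Fintype.mem_piFinset, Finset.mem_Icc]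
  intro i
  have h1 := (norm_le_pi_norm _ i).trans (hr _ hj)
  rw [Pi.smul_apply, norm_smul, Real.norm_of_nonneg hh.le, latticePoint] at h1
  have h2 : ‖(j i : ℝ)‖ ≤ N := le_trans (by rwa [le_inv_mul_iff₀ hh]) hN
  rw [Real.norm_eq_abs, abs_le] at h2
  exact_mod_cast h2

/-- The quasi-interpolant `x ↦ ∑_j φ_k (x / h - j) c (h j)`, summed over the integer lattice. -/
noncomputable def splineSum {d : ℕ} {F : Type*} [AddCommGroup F] [Module ℝ F] (h : ℝ)
    (k : Fin d → ℕ) (c : (Fin d → ℝ) → F) (x : Fin d → ℝ) : F :=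
  ∑ᶠ j : Fin d → ℤ, splineKernel k (h⁻¹ • x - latticePoint j) • c (h • latticePoint j)

section splineSum

variable {d : ℕ} {F : Type*} [AddCommGroup F] [Module ℝ F] {h : ℝ}

theorem splineSum_eq_sum (k : Fin d → ℕ) {c : (Fin d → ℝ) → F} {T : Finset (Fin d → ℤ)}
    (hT : ∀ j, c (h • latticePoint j) ≠ 0 → j ∈ T) (x : Fin d → ℝ) :
    splineSum h k c x =
      ∑ j ∈ T, splineKernel k (h⁻¹ • x - latticePoint j) • c (h • latticePoint j) := by
  refine finsum_eq_sum_of_support_subset _ fun j hj => hT j fun h0 => hj ?_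
  simp [h0]

/-- Summation by parts: a forward difference of the kernels is moved to the coefficients. -/
theorem splineSum_fwdDiff (hh : 0 < h) (k : Fin d → ℕ) (i : Fin d) {c : (Fin d → ℝ) → F}
    (hc : Bornology.IsBounded (Function.support c)) (x : Fin d → ℝ) :
    splineSum h k (fwdDiff (h • Pi.single i 1) c) x =
      ∑ᶠ j : Fin d → ℤ, (splineKernel k (h⁻¹ • x - latticePoint j + Pi.single i 1) -
        splineKernel k (h⁻¹ • x - latticePoint j)) • c (h • latticePoint j) := by
  have hfin := finite_setOf_latticePoint_mem hh hc
  have hs : ∀ u : (Fin d → ℤ) → ℝ,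
      (Function.support fun j => u j • c (h • latticePoint j)).Finite := fun u =>
    hfin.subset fun j hj h0 => hj (by simp [h0])
  have hlat : ∀ j : Fin d → ℤ, latticePoint (j + Pi.single i 1) =
      latticePoint j + (Pi.single i 1 : Fin d → ℝ) := by
    intro j
    funext m
    by_cases hm : m = i
    · subst hm
      simp [latticePoint]
    · simp [latticePoint, hm]
  have key : ∑ᶠ j : Fin d → ℤ, splineKernel k (h⁻¹ • x - latticePoint j + Pi.single i 1) •
        c (h • latticePoint j) =
      ∑ᶠ j : Fin d → ℤ, splineKernel k (h⁻¹ • x - latticePoint j) •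
        c (h • latticePoint j + h • Pi.single i 1) := by
    rw [← finsum_comp_equiv (Equiv.addRight (Pi.single i 1 : Fin d → ℤ))]
    refine finsum_congr fun j => ?_
    rw [Equiv.coe_addRight, hlat, smul_add, ← sub_sub, sub_add_cancel]
  have hs' : (Function.support fun j : Fin d → ℤ =>
      splineKernel k (h⁻¹ • x - latticePoint j) •
        c (h • latticePoint j + h • Pi.single i 1)).Finite := by
    refine ((hfin.preimage (add_left_injective (Pi.single i 1 : Fin d → ℤ)).injOn)).subset ?_
    intro j hj
    simp only [Set.mem_preimage, Set.mem_ofPred_eq, hlat, smul_add]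
    exact fun h0 => hj (by simp [h0])
  simp only [sub_smul]
  rw [finsum_sub_distrib (hs _) (hs _), key, ← finsum_sub_distrib hs' (hs _)]
  simp only [splineSum, fwdDiff, smul_sub]

variable [TopologicalSpace F] [IsTopologicalAddGroup F] [ContinuousSMul ℝ F]

/-- A partial derivative of a spline sum is the spline sum of lower order of the difference
quotients of its coefficients. -/
theorem tendsto_slope_splineSum (hh : 0 < h) {k k' : Fin d → ℕ} {i : Fin d} (hi : k i = k' i + 1)
    (hne : ∀ m, m ≠ i → k m = k' m) {c : (Fin d → ℝ) → F}
    (hc : Bornology.IsBounded (Function.support c)) (x : Fin d → ℝ) :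
    Tendsto (fun t : ℝ => t⁻¹ • (splineSum h k c (x + t • Pi.single i 1) - splineSum h k c x))
      (𝓝[≠] 0) (𝓝 (h⁻¹ • splineSum h k' (fwdDiff (h • Pi.single i 1) c) x)) := by
  have hfin := finite_setOf_latticePoint_mem hh hc
  have hT : ∀ j, c (h • latticePoint j) ≠ 0 → j ∈ hfin.toFinset := fun j hj => by simpa using hj
  have hd : ∀ j : Fin d → ℤ, Tendsto (fun t : ℝ => t⁻¹ •
      (splineKernel k (h⁻¹ • (x + t • Pi.single i 1) - latticePoint j) -
        splineKernel k (h⁻¹ • x - latticePoint j))) (𝓝[≠] 0)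
      (𝓝 (h⁻¹ * (splineKernel k' (h⁻¹ • x - latticePoint j + Pi.single i 1) -
        splineKernel k' (h⁻¹ • x - latticePoint j)))) := by
    intro j
    have h1 := splineKernel.hasLineDerivAt hi hne (h⁻¹ • x - latticePoint j)
    have h2 := (h1.smul h⁻¹).tendsto_slope_zero
    refine h2.congr fun t => ?_
    rw [smul_comm t, smul_add, add_sub_right_comm]
  simp only [splineSum_eq_sum k hT]
  rw [splineSum_fwdDiff hh k' i hc, finsum_eq_sum_of_support_subset (s := hfin.toFinset) _
    fun j hj => by
      refine hT j fun h0 => hj ?_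
      simp [h0], Finset.smul_sum]
  have h3 := tendsto_finsetSum hfin.toFinset fun j _ => (hd j).smul_const (c (h • latticePoint j))
  simp only [mul_smul] at h3
  refine h3.congr fun t => ?_
  rw [← Finset.sum_sub_distrib, Finset.smul_sum]
  refine Finset.sum_congr rfl fun j _ => ?_
  rw [smul_assoc, sub_smul]

end splineSum

namespace VectorCk

variable {d : ℕ} {Ω : TopologicalSpace.Opens (Fin d → ℝ)}
  {F : Type*} [AddCommGroup F] [Module ℝ F] [TopologicalSpace F]

theorem hasPartialAt_restrict {g : (Fin d → ℝ) → F} {i : Fin d} {x : Ω} {v : F}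
    (h : Tendsto (fun t : ℝ => t⁻¹ • (g ((x : Fin d → ℝ) + t • Pi.single i 1) - g x))
      (𝓝[≠] 0) (𝓝 v)) :
    HasPartialAt i (fun y : Ω => g y) x v := by
  refine h.congr' ?_
  have h1 : Tendsto (fun t : ℝ => (x : Fin d → ℝ) + t • Pi.single i (1 : ℝ)) (𝓝 0)
      (𝓝 (x : Fin d → ℝ)) := by
    have : Continuous fun t : ℝ => (x : Fin d → ℝ) + t • Pi.single i (1 : ℝ) := by fun_prop
    simpa using this.tendsto 0
  filter_upwards [nhdsWithin_le_nhds (h1 (Ω.isOpen.mem_nhds x.2))] with t ht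
  have h2 := extend_coe (fun y : Ω => g y) ⟨_, ht⟩
  simp only at h2
  rw [diffQuot, h2]

theorem exists_contDiff_wordDeriv {u : (Fin d → ℝ) → ℝ} (hu : ContDiff ℝ (⊤ : ℕ∞) u)
    (w : List (Fin d)) : WordDerivExists w (fun x : Ω => u x) ∧
      ∃ v : (Fin d → ℝ) → ℝ, ContDiff ℝ (⊤ : ℕ∞) v ∧
        wordDeriv w (fun x : Ω => u x) = fun x : Ω => v x := by
  induction w with
  | nil => exact ⟨trivial, u, hu, rfl⟩
  | cons i w ih =>
    obtain ⟨h1, v, hv, h2⟩ := ih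
    have h3 : ∀ x : Ω, HasPartialAt i (wordDeriv w fun x : Ω => u x) x
        (fderiv ℝ v x (Pi.single i 1)) := by
      intro x
      rw [h2]
      have h4 : DifferentiableAt ℝ v x := hv.differentiable (by simp) _
      exact hasPartialAt_restrict (h4.hasFDerivAt.hasLineDerivAt _).tendsto_slope_zero
    refine ⟨⟨h1, fun x => ⟨_, h3 x⟩⟩, fun x => fderiv ℝ v x (Pi.single i 1), ?_,
      funext fun x => (h3 x).pderiv_eq⟩
    exact (hv.fderiv_right (m := (⊤ : ℕ∞)) (by simp)).clm_apply contDiff_const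

theorem isCk_top_of_contDiff {u : (Fin d → ℝ) → ℝ} (hu : ContDiff ℝ (⊤ : ℕ∞) u) :
    IsCk ⊤ (fun x : Ω => u x) := by
  intro α _
  obtain ⟨h1, v, hv, h2⟩ := exists_contDiff_wordDeriv (Ω := Ω) hu (indexWord α)
  refine ⟨h1, ?_⟩
  rw [partialDeriv, h2]
  exact hv.continuous.comp continuous_subtype_val

theorem length_indexWord (α : Fin d → ℕ) : (indexWord α).length = ∑ i, α i := by
  simp [indexWord, List.length_flatMap, Fin.sum_univ_def]

variable [IsTopologicalAddGroup F] [ContinuousSMul ℝ F] [T2Space F]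

/-- Iterated partial derivatives of spline sums are spline sums of iterated difference quotients. -/
theorem wordDeriv_splineSum {h : ℝ} (hh : 0 < h) {ℓ : ℕ} {c : (Fin d → ℝ) → F}
    (hc : Bornology.IsBounded (Function.support c)) {w : List (Fin d)} (hw : w.length ≤ ℓ) :
    wordDeriv w (fun x : Ω => splineSum h (fun _ => ℓ) c x) =
      fun x : Ω => (h⁻¹) ^ w.length •
        splineSum h (fun i => ℓ - w.count i) (wordDiff h w c) x := by
  induction w with
  | nil => simp [wordDeriv, wordDiff]
  | cons i w ih =>
    funext x
    refine HasPartialAt.pderiv_eq ?_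
    rw [ih (by simp at hw; omega)]
    refine hasPartialAt_restrict (g := fun x => (h⁻¹) ^ w.length •
        splineSum h (fun i => ℓ - w.count i) (wordDiff h w c) x) ?_
    have h1 := List.count_le_length (a := i) (l := w)
    have h2 := tendsto_slope_splineSum hh (k := fun i => ℓ - w.count i)
      (k' := fun m => ℓ - (i :: w).count m) (i := i)
      (by simp at hw ⊢; omega) (fun m hm => by simp [List.count_cons_of_ne hm.symm])
      (hc.support_wordDiff (h := h) w) x
    have h3 := h2.const_smul ((h⁻¹) ^ w.length)
    rw [smul_smul, ← pow_succ] at h3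
    refine h3.congr fun t => ?_
    rw [smul_comm, smul_sub]

end VectorCk

/-! ### Sampling operators -/

namespace CkSpace

open VectorCk

variable {d : ℕ} {ℓ : ℕ∞} {Ω : TopologicalSpace.Opens (Fin d → ℝ)}
  {F : Type*} [AddCommGroup F] [Module ℝ F] [TopologicalSpace F]
  [IsTopologicalAddGroup F] [ContinuousSMul ℝ F] [T2Space F]

theorem continuous_partialMap (α : Fin d → ℕ) (hα : ((∑ i, α i : ℕ) : ℕ∞) ≤ ℓ) :
    Continuous (partialMap α hα : CkSpace ℓ Ω F → C(Ω, F)) :=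
  continuous_iff_le_induced.2 (iInf₂_le α hα)

theorem continuous_rng_iff {X : Type*} [TopologicalSpace X] {f : X → CkSpace ℓ Ω F} :
    Continuous f ↔ ∀ α (hα : ((∑ i, α i : ℕ) : ℕ∞) ≤ ℓ), Continuous (partialMap α hα ∘ f) := by
  simp only [continuous_iInf_rng, continuous_induced_rng]

instance : ContinuousAdd (CkSpace ℓ Ω F) where
  continuous_add := by
    refine continuous_rng_iff.2 fun α hα => ?_
    have h1 : partialMap α hα ∘ (fun p : CkSpace ℓ Ω F × CkSpace ℓ Ω F => p.1 + p.2) =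
        fun p => partialMap α hα p.1 + partialMap α hα p.2 := by
      funext p
      exact ContinuousMap.ext fun x =>
        congrFun (wordDeriv_add _ (p.1.2 α hα).1 (p.2.2 α hα).1).2 x
    rw [h1]
    exact ((continuous_partialMap α hα).comp continuous_fst).add
      ((continuous_partialMap α hα).comp continuous_snd)

/-- Evaluation at a point, as a continuous linear map on `C^ℓ(Ω, F)`. -/
noncomputable def evalCLM (p : Ω) : CkSpace ℓ Ω F →L[ℝ] F where
  toFun γ := (γ : Ω → F) p
  map_add' _ _ := rfl
  map_smul' _ _ := rfl
  cont := by
    have h1 := (continuous_eval_const p).comp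
      (continuous_partialMap (ℓ := ℓ) (F := F) (Ω := Ω) 0 (by simp))
    refine h1.congr fun γ => ?_
    have h2 : indexWord (0 : Fin d → ℕ) = [] := List.eq_nil_of_length_eq_zero (by
      rw [length_indexWord]; simp)
    simp [partialMap, partialDeriv, h2, wordDeriv]

/-- The map `v ↦ (x ↦ η(x) v)` for a fixed scalar function `η`, as a continuous linear map. -/
noncomputable def smulVecCLM (η : CkSpace ℓ Ω ℝ) : F →L[ℝ] CkSpace ℓ Ω F where
  toLinearMap := smulVec.flip η
  cont := by
    refine continuous_rng_iff.2 fun α hα => ?_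
    refine ContinuousMap.continuous_of_continuous_uncurry _ ?_
    have h1 : Function.uncurry (fun (v : F) (x : Ω) => partialMap α hα (smulVec.flip η v) x) =
        fun p => partialMap α hα η p.2 • p.1 := by
      funext p
      exact congrFun (wordDeriv_comp (ContinuousLinearMap.toSpanSingleton ℝ p.1) _
        (η.2 α hα).1).2 p.2
    exact h1 ▸ ((partialMap α hα η).continuous.comp continuous_snd).smul continuous_fst

/-- The operator `γ ↦ ∑_j u_j γ(p_j)` built from finitely many sampling points `p_j` and smooth
scalar functions `u_j`. -/
noncomputable def samplingCLM {ι : Type*} [Fintype ι] (p : ι → Ω) (u : ι → CkSpace ⊤ Ω ℝ) :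
    CkSpace ℓ Ω F →L[ℝ] CkSpace ⊤ Ω F :=
  ∑ j, (smulVecCLM (u j)).comp (evalCLM (p j))

theorem samplingCLM_eq {ι : Type*} [Fintype ι] (p : ι → Ω) (u : ι → CkSpace ⊤ Ω ℝ)
    (γ : CkSpace ℓ Ω F) : samplingCLM p u γ = ∑ j, smulVec ((γ : Ω → F) (p j)) (u j) := by
  simp only [samplingCLM, _root_.sum_apply]
  rfl

theorem sum_apply {ι : Type*} (s : Finset ι) (f : ι → CkSpace ℓ Ω F) (x : Ω) :
    (∑ j ∈ s, f j : CkSpace ℓ Ω F).1 x = ∑ j ∈ s, (f j).1 x :=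
  map_sum (evalCLM x) f s

theorem smulVec_mem_tensorSuppIn {K : Set Ω} {η : CkSpace ℓ Ω ℝ} (hη : η ∈ suppIn ℓ ℝ K) (v : F) :
    smulVec v η ∈ tensorSuppIn ℓ F K :=
  ⟨v ⊗ₜ ⟨η, hη⟩, by simp⟩

theorem samplingCLM_mem_tensorSuppIn {ι : Type*} [Fintype ι] {p : ι → Ω} {u : ι → CkSpace ⊤ Ω ℝ}
    {γ : CkSpace ℓ Ω F} {K : Set Ω}
    (h : ∀ j, (γ : Ω → F) (p j) ≠ 0 → u j ∈ suppIn ⊤ ℝ K) :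
    samplingCLM p u γ ∈ tensorSuppIn ⊤ F K := by
  rw [samplingCLM_eq]
  refine Submodule.sum_mem _ fun j _ => ?_
  by_cases h0 : (γ : Ω → F) (p j) = 0
  · rw [h0, map_zero, LinearMap.zero_apply]
    exact Submodule.zero_mem _
  · exact smulVec_mem_tensorSuppIn (h j h0) _

/-- Convergence in `C^ℓ(Ω, F)`, tested on compact sets and closed convex neighbourhoods of `0`. -/
theorem tendsto_of_eventually_forall_mem [LocallyConvexSpace ℝ F] {X : Type*} {l : Filter X}
    {f : X → CkSpace ℓ Ω F} {γ : CkSpace ℓ Ω F}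
    (h : ∀ α : Fin d → ℕ, ((∑ i, α i : ℕ) : ℕ∞) ≤ ℓ → ∀ C : Set Ω, IsCompact C →
      ∀ V ∈ 𝓝 (0 : F), Convex ℝ V → IsClosed V →
        ∀ᶠ n in l, ∀ x ∈ C, partialDeriv α (f n) x - partialDeriv α γ x ∈ V) :
    Tendsto f l (𝓝 γ) := by
  rw [nhds_iInf, tendsto_iInf]
  intro α
  rw [nhds_iInf, tendsto_iInf]
  intro hα
  rw [nhds_induced, tendsto_comap_iff]
  let _ := IsTopologicalAddGroup.rightUniformSpace F
  have : IsUniformAddGroup F := isUniformAddGroup_of_addCommGroup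
  rw [ContinuousMap.tendsto_iff_forall_isCompact_tendstoUniformlyOn]
  intro C hC U hU
  rw [uniformity_eq_comap_nhds_zero F, mem_comap] at hU
  obtain ⟨W, hW, hWU⟩ := hU
  obtain ⟨W', hW', hW'c, hW'W⟩ := exists_mem_nhds_isClosed_subset hW
  obtain ⟨V, ⟨hV, hVc⟩, hVW⟩ := (LocallyConvexSpace.convex_basis_zero ℝ F).mem_iff.1 hW'
  filter_upwards [h α hα C hC (closure V) (mem_of_superset hV subset_closure) hVc.closure
    isClosed_closure] with n hn x hx
  exact hWU (hW'W (closure_minimal hVW hW'c (hn x hx)))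

end CkSpace

/-! ### Spline operators and their convergence -/

namespace CkSpace

open VectorCk

variable {d : ℕ} {Ω : TopologicalSpace.Opens (Fin d → ℝ)}

/-- The spline kernel of order `ℓ`, scaled by `h` and centred at the lattice point `h j`, as a
smooth function on `Ω`. -/
noncomputable def splineFun (ℓ : ℕ) (h : ℝ) (j : Fin d → ℤ) : CkSpace ⊤ Ω ℝ :=
  ⟨fun x => splineKernel (fun _ => ℓ) (h⁻¹ • (x : Fin d → ℝ) - latticePoint j),
    isCk_top_of_contDiff
      (u := fun x => splineKernel (fun _ => ℓ) (h⁻¹ • x - latticePoint j))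
      ((splineKernel.contDiff _).comp ((contDiff_id.const_smul _).sub contDiff_const))⟩

theorem norm_sub_le_of_splineKernel_ne_zero {h : ℝ} (hh : 0 < h) {k : Fin d → ℕ} {ℓ : ℕ}
    (hk : ∀ i, k i ≤ ℓ) {x : Fin d → ℝ} {j : Fin d → ℤ}
    (hx : splineKernel k (h⁻¹ • x - latticePoint j) ≠ 0) :
    ‖x - h • latticePoint j‖ ≤ (ℓ + 1) * h := by
  have h1 := splineKernel.norm_le_of_ne_zero hk hx
  have h2 : x - h • latticePoint j = h • (h⁻¹ • x - latticePoint j) := by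
    rw [smul_sub, smul_inv_smul₀ hh.ne']
  rw [h2, norm_smul, Real.norm_of_nonneg hh.le, mul_comm]
  exact mul_le_mul_of_nonneg_right h1 hh.le

theorem splineFun_mem_suppIn {h : ℝ} (hh : 0 < h) (ℓ : ℕ) (j : Fin d → ℤ) {K : Set Ω}
    (hK : ∀ x : Ω, ‖(x : Fin d → ℝ) - h • latticePoint j‖ ≤ (ℓ + 1) * h → x ∈ K) :
    splineFun ℓ h j ∈ suppIn ⊤ ℝ K := by
  have hcl : IsClosed {x : Ω | ‖(x : Fin d → ℝ) - h • latticePoint j‖ ≤ (ℓ + 1) * h} :=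
    isClosed_le (by fun_prop) continuous_const
  refine (closure_minimal (fun x hx => ?_) hcl).trans hK
  exact norm_sub_le_of_splineKernel_ne_zero hh (fun _ => le_rfl) hx

theorem isBounded_coe_image {K : Set Ω} (hK : IsCompact K) :
    Bornology.IsBounded ((↑) '' K : Set (Fin d → ℝ)) :=
  (hK.image continuous_subtype_val).isBounded

/-- The values of `γ` on `K`, extended by zero to the whole space. -/
noncomputable def cutoff {F : Type*} [AddCommGroup F] (K : Set Ω) (γ : Ω → F) : (Fin d → ℝ) → F :=
  ((↑) '' K : Set (Fin d → ℝ)).indicator (Function.extend (Subtype.val : Ω → Fin d → ℝ) γ 0)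

theorem cutoff_of_mem {F : Type*} [AddCommGroup F] {K : Set Ω} (γ : Ω → F) {x : Ω} (hx : x ∈ K) :
    cutoff K γ x = γ x := by
  rw [cutoff, Set.indicator_of_mem (Set.mem_image_of_mem _ hx), extend_coe]

theorem isBounded_support_cutoff {F : Type*} [AddCommGroup F] {K : Set Ω} (hK : IsCompact K)
    (γ : Ω → F) : Bornology.IsBounded (Function.support (cutoff K γ)) :=
  (isBounded_coe_image hK).subset Set.support_indicator_subset

variable {F : Type*} [AddCommGroup F] [Module ℝ F] [TopologicalSpace F]
  [IsTopologicalAddGroup F] [ContinuousSMul ℝ F] [T2Space F]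

/-- Only finitely many points of the lattice `h ℤ^d` belong to a compact set. -/
noncomputable abbrev fintypeLattice {h : ℝ} (hh : 0 < h) {K : Set Ω} (hK : IsCompact K) :
    Fintype {j : Fin d → ℤ // ∃ p ∈ K, (p : Fin d → ℝ) = h • latticePoint j} :=
  Fintype.subtype (finite_setOf_latticePoint_mem hh (isBounded_coe_image hK)).toFinset
    (by simp)

variable (F) in
/-- The operator that sends `γ` to the spline sum over the points of the lattice `h ℤ^d` in the
compact set `K`, with the values of `γ` as coefficients. -/
noncomputable def splineCLM (ℓ : ℕ) {h : ℝ} (hh : 0 < h) {K : Set Ω} (hK : IsCompact K) :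
    CkSpace ℓ Ω F →L[ℝ] CkSpace ⊤ Ω F :=
  haveI := fintypeLattice hh hK
  samplingCLM
    (fun j : {j : Fin d → ℤ // ∃ p ∈ K, (p : Fin d → ℝ) = h • latticePoint j} => j.2.choose)
    (fun j => splineFun ℓ h j)

theorem splineCLM_mem_tensorSuppIn {ℓ : ℕ} {h : ℝ} (hh : 0 < h) {K L : Set Ω} (hK : IsCompact K)
    {γ : CkSpace ℓ Ω F}
    (hL : ∀ p ∈ K, (γ : Ω → F) p ≠ 0 → ∀ x : Ω, ‖(x : Fin d → ℝ) - p‖ ≤ (ℓ + 1) * h → x ∈ L) :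
    splineCLM F ℓ hh hK γ ∈ tensorSuppIn ⊤ F L := by
  let _ := fintypeLattice hh hK
  unfold splineCLM
  refine samplingCLM_mem_tensorSuppIn ?_
  rintro ⟨j, hj⟩ hne
  refine splineFun_mem_suppIn hh ℓ j fun x hx => ?_
  have h1 := hj.choose_spec
  exact hL _ h1.1 hne x (by rwa [h1.2])

theorem splineCLM_apply {ℓ : ℕ} {h : ℝ} (hh : 0 < h) {K : Set Ω} (hK : IsCompact K)
    (γ : CkSpace ℓ Ω F) :
    (splineCLM F ℓ hh hK γ).1 = fun x : Ω => splineSum h (fun _ => ℓ) (cutoff K γ.1) x := by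
  funext x
  have hfin := finite_setOf_latticePoint_mem hh (isBounded_coe_image hK)
  let _ := fintypeLattice hh hK
  have hmem : ∀ j : Fin d → ℤ, j ∈ hfin.toFinset ↔
      ∃ p ∈ K, (p : Fin d → ℝ) = h • latticePoint j := by simp
  have h0 := splineSum_eq_sum (h := h) (fun _ => ℓ) (c := cutoff K γ.1) (T := hfin.toFinset)
    (fun j hj => by simpa using Set.mem_of_indicator_ne_zero hj) x
  rw [h0, Finset.sum_subtype _ hmem]
  refine ((congrArg (fun η : CkSpace ⊤ Ω F => η.1 x) (samplingCLM_eq _ _ γ)).trans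
    (sum_apply _ _ x)).trans ?_
  refine Finset.sum_congr (by congr!) fun j _ => ?_
  have h1 := j.2.choose_spec
  rw [(congrArg (cutoff K γ.1) h1.2).symm.trans (cutoff_of_mem _ h1.1)]
  rfl

/-- The local error estimate: near `x`, the derivatives of the spline sum are convex combinations
of difference quotients of `γ`, hence remain in closed convex sets containing the corresponding
derivative of `γ` near `x`. -/
theorem partialDeriv_splineCLM_mem [LocallyConvexSpace ℝ F] {ℓ : ℕ} {h : ℝ} (hh : 0 < h)
    {K : Set Ω} (hK : IsCompact K) (γ : CkSpace ℓ Ω F) {α : Fin d → ℕ} (hα : ∑ i, α i ≤ ℓ) {x : Ω}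
    (hx : Metric.closedBall (x : Fin d → ℝ) ((2 * ℓ + 1) * h) ⊆ (↑) '' K)
    {A : Set F} (hA : Convex ℝ A) (hA' : IsClosed A)
    (hmem : ∀ z : Ω, ‖(z : Fin d → ℝ) - x‖ ≤ (2 * ℓ + 1) * h → partialDeriv α γ z ∈ A) :
    partialDeriv α (splineCLM F ℓ hh hK γ) x ∈ A := by
  have hw : (indexWord α).length ≤ ℓ := by rwa [length_indexWord]
  rw [partialDeriv, splineCLM_apply,
    wordDeriv_splineSum hh (isBounded_support_cutoff hK γ.1) hw]
  simp only [splineSum, smul_finsum, smul_comm (h⁻¹ ^ (indexWord α).length)]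
  refine hA.finsum_mem (fun _ => splineKernel.nonneg _ _) (splineKernel.finsum_translates _ _)
    fun j hj => ?_
  have h1 := norm_sub_le_of_splineKernel_ne_zero hh (fun i => Nat.sub_le _ _) hj
  have h2 : ∀ z ∈ Metric.closedBall (h • latticePoint j) ((indexWord α).length * h),
      ‖z - (x : Fin d → ℝ)‖ ≤ (2 * ℓ + 1) * h := by
    intro z hz
    rw [mem_closedBall_iff_norm] at hz
    rw [norm_sub_rev] at h1
    have h3 := norm_sub_le_norm_sub_add_norm_sub z (h • latticePoint j) (x : Fin d → ℝ)
    have h4 : ((indexWord α).length : ℝ) * h ≤ ℓ * h :=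
      mul_le_mul_of_nonneg_right (by exact_mod_cast hw) hh.le
    linarith
  have h3 : ∀ z ∈ Metric.closedBall (h • latticePoint j) ((indexWord α).length * h),
      z ∈ ((↑) '' K : Set (Fin d → ℝ)) := fun z hz =>
    hx (mem_closedBall_iff_norm.2 (h2 z hz))
  refine WordDerivExists.wordDiff_mem (γ.2 α (by exact_mod_cast hα)).1 hh ?_ ?_ hA hA' ?_
  · intro z hz
    obtain ⟨y, -, rfl⟩ := h3 z hz
    exact y.2
  · intro z hz
    obtain ⟨y, hy, hyz⟩ := h3 z hz
    exact cutoff_of_mem γ.1 (Subtype.ext hyz ▸ hy)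
  · exact fun z hz => hmem z (h2 z hz)

end CkSpace

/-! ### The approximating sequence -/

/-- In a compact exhaustion `K` of an open set, a uniform neighbourhood of `K n` lies in
`K (n + 1)`. -/
theorem CompactExhaustion.exists_closedBall_subset {d : ℕ}
    {Ω : TopologicalSpace.Opens (Fin d → ℝ)} (K : CompactExhaustion Ω) (n : ℕ) :
    ∃ δ > 0, ∀ x ∈ K n, Metric.closedBall (x : Fin d → ℝ) δ ⊆ (↑) '' K (n + 1) := by
  have h1 : IsOpen ((↑) '' interior (K (n + 1)) : Set (Fin d → ℝ)) :=
    Ω.isOpen.isOpenMap_subtype_val _ isOpen_interior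
  obtain ⟨δ, hδ, hsub⟩ := ((K.isCompact n).image continuous_subtype_val).exists_cthickening_subset_open
    h1 (Set.image_mono (K.subset_interior_succ n))
  refine ⟨δ, hδ, fun x hx => ?_⟩
  exact (Metric.closedBall_subset_cthickening (Set.mem_image_of_mem _ hx) δ).trans
    (hsub.trans (Set.image_mono interior_subset))

/-- There are mesh sizes `h n → 0` so small that for all `k ≤ n` the points at distance at most
`R * h n` from `K k` belong to `K (k + 1)`. -/
theorem CompactExhaustion.exists_meshSize {d : ℕ}
    {Ω : TopologicalSpace.Opens (Fin d → ℝ)} (K : CompactExhaustion Ω) (R : ℝ) :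
    ∃ h : ℕ → ℝ, (∀ n, 0 < h n) ∧ Tendsto h atTop (𝓝 0) ∧ ∀ k n, k ≤ n →
      ∀ x ∈ K k, Metric.closedBall (x : Fin d → ℝ) (R * h n) ⊆ (↑) '' K (k + 1) := by
  choose δ hδ hsub using K.exists_closedBall_subset
  have h1 : ∀ n : ℕ, ∃ h : ℝ, 0 < h ∧ h < 1 / ((n : ℝ) + 1) ∧ ∀ k ≤ n, R * h ≤ δ k := by
    intro n
    have h2 : ∀ᶠ h : ℝ in 𝓝 0, ∀ k ≤ n, R * h ≤ δ k := by
      refine (Set.finite_Iic n).eventually_all.2 fun k _ => ?_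
      have h3 : Tendsto (fun h : ℝ => R * h) (𝓝 0) (𝓝 (R * 0)) :=
        (continuous_const.mul continuous_id).tendsto 0
      rw [mul_zero] at h3
      exact (h3.eventually_lt_const (hδ k)).mono fun _ => le_of_lt
    have h4 : ∀ᶠ h : ℝ in 𝓝 0, h < 1 / ((n : ℝ) + 1) := eventually_lt_nhds (by positivity)
    obtain ⟨h, hh⟩ := ((eventually_mem_nhdsWithin (a := (0 : ℝ)) (s := Set.Ioi 0)).and
      (nhdsWithin_le_nhds (h4.and h2))).exists
    exact ⟨h, hh.1, hh.2⟩
  choose h hpos hlt hR using h1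
  refine ⟨h, hpos, squeeze_zero (fun n => (hpos n).le) (fun n => (hlt n).le)
    tendsto_one_div_add_atTop_nhds_zero_nat, fun k n hkn x hx => ?_⟩
  exact (Metric.closedBall_subset_closedBall (hR n k hkn)).trans (hsub k x hx)

theorem theorem1p1 {d : ℕ} (Ω : TopologicalSpace.Opens (Fin d → ℝ))
    (F : Type*) [AddCommGroup F] [Module ℝ F] [TopologicalSpace F]
    [IsTopologicalAddGroup F] [ContinuousSMul ℝ F] [LocallyConvexSpace ℝ F] [T2Space F]
    (K : CompactExhaustion Ω) (ℓ : ℕ) :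
    ∃ S : ℕ → (CkSpace (ℓ : ℕ∞) Ω F →L[ℝ] CkSpace (⊤ : ℕ∞) Ω F),
      (∀ γ : CkSpace (ℓ : ℕ∞) Ω F,
        Tendsto (fun n => CkSpace.incl (le_top : (ℓ : ℕ∞) ≤ ⊤) (S n γ)) atTop (𝓝 γ)) ∧
      (∀ (n : ℕ) (γ : CkSpace (ℓ : ℕ∞) Ω F),
        S n γ ∈ CkSpace.tensorSuppIn (⊤ : ℕ∞) F (K (n + 1))) ∧
      (∀ n m : ℕ, n ≤ m → ∀ γ ∈ CkSpace.suppIn (ℓ : ℕ∞) F (K n),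
        S m γ ∈ CkSpace.tensorSuppIn (⊤ : ℕ∞) F (K (n + 1))) := by
  -- kernels reach `(ℓ + 1) * h` far from their lattice point, difference quotients `ℓ * h` further
  obtain ⟨h, hpos, hlim, hsub⟩ := K.exists_meshSize (2 * ℓ + 1)
  have hball : ∀ k n, k ≤ n → ∀ p ∈ K k, ∀ x : Ω,
      ‖(x : Fin d → ℝ) - p‖ ≤ (ℓ + 1) * h n → x ∈ K (k + 1) := by
    intro k n hkn p hp x hx
    have h1 : (0 : ℝ) ≤ ℓ * h n := mul_nonneg (Nat.cast_nonneg _) (hpos n).le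
    obtain ⟨y, hy, hyx⟩ := hsub k n hkn p hp
      (mem_closedBall_iff_norm.2 (show ‖(x : Fin d → ℝ) - p‖ ≤ (2 * ℓ + 1) * h n by linarith))
    exact Subtype.ext hyx ▸ hy
  refine ⟨fun n => CkSpace.splineCLM F ℓ (hpos n) (K.isCompact n), fun γ => ?_, fun n γ => ?_,
    fun n m hnm γ hγ => ?_⟩
  · refine CkSpace.tendsto_of_eventually_forall_mem fun α hα C hC V hV hVc hVcl => ?_
    obtain ⟨k, hk⟩ := K.exists_superset_of_isCompact hC
    -- uniform continuity of `∂^α γ` on the compact set `K (k + 1)`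
    let _ := IsTopologicalAddGroup.rightUniformSpace F
    have : IsUniformAddGroup F := isUniformAddGroup_of_addCommGroup
    have huc := (K.isCompact (k + 1)).uniformContinuousOn_of_continuous
      (γ.2 α hα).2.continuousOn
    have hU : {p : F × F | p.2 - p.1 ∈ V} ∈ uniformity F := by
      rw [uniformity_eq_comap_nhds_zero F]
      exact preimage_mem_comap hV
    have hU' := huc hU
    rw [mem_map, mem_inf_principal, Metric.mem_uniformity_dist] at hU'
    obtain ⟨ε, hε, hεV⟩ := hU'
    have hlim' : Tendsto (fun n => (2 * ℓ + 1) * h n) atTop (𝓝 0) := by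
      simpa using hlim.const_mul (2 * ℓ + 1 : ℝ)
    filter_upwards [eventually_ge_atTop (k + 1), hlim'.eventually_lt_const hε] with n hn hnε x hx
    have hxK := hsub k n (by omega) x (hk hx)
    refine sub_eq_add_neg (_ : F) _ ▸ CkSpace.partialDeriv_splineCLM_mem (hpos n) (K.isCompact n) γ (by exact_mod_cast hα)
      (A := (fun v => v + -VectorCk.partialDeriv α γ.1 x) ⁻¹' V) ?_ ?_ ?_ ?_
    · exact hxK.trans (Set.image_mono (K.subset hn))
    · exact hVc.translate_preimage_left (-VectorCk.partialDeriv α γ.1 x)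
    · exact hVcl.preimage (continuous_id.add continuous_const)
    · intro z hz
      obtain ⟨y, hy, hyz⟩ := hxK (mem_closedBall_iff_norm.2 hz)
      have hzK : z ∈ K (k + 1) := Subtype.ext hyz ▸ hy
      have hdist : dist x z < ε := by
        rw [Subtype.dist_eq, dist_comm, dist_eq_norm]
        exact hz.trans_lt hnε
      have hzx := hεV hdist ⟨K.subset_succ k (hk hx), hzK⟩
      rw [Set.mem_preimage, Set.mem_ofPred_eq] at hzx
      rwa [Set.mem_preimage, ← sub_eq_add_neg]
  · exact CkSpace.splineCLM_mem_tensorSuppIn _ _ fun p hp _ => hball n n le_rfl p hp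
  · exact CkSpace.splineCLM_mem_tensorSuppIn _ _ fun p _ hp =>
      hball n m hnm p (hγ (subset_tsupport _ hp))
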